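/- Let $\Omega$ be a countable set with a metric $d$ inducing the discrete topology, and let $g:[0,\infty)\to\mathbb{R}$ be monotone increasing and $C,D>0$ such that $$\#\{y\in\Omega : d(x,y)\le r\}\le g(r)\le C(1+r)^D\qquad (r\ge 0,\ x\in\Omega).$$ To each $x\in\Omega$ let a complex Hilbert space $\mathscr{H}_x$ be assigned. For finite $\Lambda\subset\Omega$ put $\mathscr{H}_\Lambda=\bigotimes_{x\in\Lambda}\mathscr{H}_x$ (Hilbert tensor product), let $\mathscr{A}_\Lambda$ be the algebra of bounded operators on $\mathscr{H}_\Lambda$ with the operator norm, and for $X\subset\Lambda$ regard $A\in\mathscr{A}_X$ as the element $A\otimes I$ of $\mathscr{A}_\Lambda$. For every finite $Z\subset\Omega$ let $h_Z\in\mathscr{A}_Z$ be self-adjoint, and put $$H_\Lambda=\sum_{Z\subset\Lambda}h_Z,\qquad \tau_{t,\Lambda}(A)=e^{itH_\Lambda}Ae^{-itH_\Lambda}\quad (A\in\mathscr{A}_\Lambda).$$ Assume: (i) $f:[0,\infty)\to[0,\infty)$ is a decreasing function with $$\sup_{x\in\Omega}\ \sum_{Z\ni x,\ \mathrm{diam}(Z)\ge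 R}\|h_Z\|\le f(R)\qquad (R\ge 0);$$ (ii) $\displaystyle \mathcal{C}_0=\sup_{x\in\Omega}\ \sum_{y\in\Omega}\ \sum_{Z\ni x,y}\|h_Z\|<\infty$ (the sums run over finite $Z\subset\Omega$). Then there are constants $v>0$ and $\mathcal{C}_2>0$, with $v=2e\,\mathcal{C}_0$ if $\mathcal{C}_0\neq 0$, such that for all finite $\Lambda\subset\Omega$, all $X,Y\subset\Lambda$, all $A\in\mathscr{A}_X$, $B\in\mathscr{A}_Y$, all $R\ge 1$ and all $t\ge 0$, with $r=d(X,Y)=\min\{d(x,y): x\in X,\ y\in Y\}$ and $r\vee R=\max\{r,R\}$, $$\begin{aligned}\|[\tau_{t,\Lambda}(A),B]\|\le{}& 2\|A\|\,\|B\|\,|X|\,e^{vt-r/R}+4\|A\|\,\|B\|\,|X|\,t\,g(r)f(R)\\&+2\mathcal{C}_2\|A\|\,\|B\|\,|X|^2\,tR\,(r\vee R)^D f(R)\,e^{vt-r/R}.\end{aligned}$$ In particular, $v$ and $\mathcal{C}_2$ do not depend on $\Lambda,t,R,X,Y,A,B$. -/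

import Mathlib

open scoped ENNReal lp

noncomputable section

namespace QSpin

/-! ### Amplification `A ↦ A ⊗ I` on square-summable families

`ℓ²(K, ℂ)` with `K ≃ I × J` is the Hilbert tensor product `ℓ²(I, ℂ) ⊗ ℓ²(J, ℂ)`, and an operator
on the first factor acts on it slice by slice. -/

section Ampliation

variable {I J K : Type*}

theorem summable_sq (ψ : ℓ²(I, ℂ)) : Summable fun i => ‖ψ i‖ ^ 2 := by
  have h := (memℓp_gen_iff (p := 2) (by norm_num)).1 (lp.memℓp ψ)
  simpa using h

theorem norm_sq_eq (ψ : ℓ²(I, ℂ)) : ‖ψ‖ ^ 2 = ∑' i, ‖ψ i‖ ^ 2 := by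
  have h := lp.norm_rpow_eq_tsum (p := 2) (by norm_num) ψ
  simpa using h

theorem memℓp_of_sq {f : I → ℂ} (h : Summable fun i => ‖f i‖ ^ 2) : Memℓp f 2 := by
  refine (memℓp_gen_iff (p := 2) (by norm_num)).2 ?_
  simpa using h

/-- The vector `ψ(·, j)`. -/
def slice (e : K ≃ I × J) (ψ : ℓ²(K, ℂ)) (j : J) : ℓ²(I, ℂ) :=
  ⟨fun i => ψ (e.symm (i, j)), memℓp_of_sq ((summable_sq ψ).comp_injective
    (i := fun i => e.symm (i, j)) (fun a b hab => by simpa using hab))⟩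

@[simp] theorem slice_apply (e : K ≃ I × J) (ψ : ℓ²(K, ℂ)) (j : J) (i : I) :
    slice e ψ j i = ψ (e.symm (i, j)) := rfl

theorem hasSum_slice (e : K ≃ I × J) (ψ : ℓ²(K, ℂ)) :
    HasSum (fun j => ‖slice e ψ j‖ ^ 2) (‖ψ‖ ^ 2) := by
  have h1 : Summable fun p : J × I => ‖ψ (e.symm (p.2, p.1))‖ ^ 2 :=
    (summable_sq ψ).comp_injective (i := fun p : J × I => e.symm (p.2, p.1))
      (fun a b hab => by
        have := e.symm.injective hab
        simp only [Prod.mk.injEq] at this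
        exact Prod.ext this.2 this.1)
  have h2 : HasSum (fun p : J × I => ‖ψ (e.symm (p.2, p.1))‖ ^ 2) (‖ψ‖ ^ 2) := by
    rw [norm_sq_eq, ← ((Equiv.prodComm J I).trans e.symm).tsum_eq fun k => ‖ψ k‖ ^ 2]
    exact h1.hasSum
  refine h2.prod_fiberwise fun j => ?_
  rw [norm_sq_eq]
  exact (summable_sq (slice e ψ j)).hasSum

theorem hasSum_amp (e : K ≃ I × J) (A : ℓ²(I, ℂ) →L[ℂ] ℓ²(I, ℂ)) (ψ : ℓ²(K, ℂ)) :
    ∃ s, s ≤ (‖A‖ * ‖ψ‖) ^ 2 ∧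
      HasSum (fun k => ‖A (slice e ψ (e k).2) (e k).1‖ ^ 2) s := by
  have hle : ∀ j, ‖A (slice e ψ j)‖ ^ 2 ≤ ‖A‖ ^ 2 * ‖slice e ψ j‖ ^ 2 := fun j => by
    rw [← mul_pow]
    exact pow_le_pow_left₀ (norm_nonneg _) (A.le_opNorm _) 2
  have hs : Summable fun j => ‖A (slice e ψ j)‖ ^ 2 :=
    Summable.of_nonneg_of_le (fun _ => by positivity) hle
      ((hasSum_slice e ψ).summable.mul_left _)
  have h1 : Summable fun p : J × I => ‖A (slice e ψ p.1) p.2‖ ^ 2 := by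
    refine (summable_prod_of_nonneg fun _ => sq_nonneg _).2
      ⟨fun j => summable_sq (A (slice e ψ j)), ?_⟩
    exact hs.congr fun j => norm_sq_eq (A (slice e ψ j))
  have h2 : HasSum (fun p : J × I => ‖A (slice e ψ p.1) p.2‖ ^ 2)
      (∑' j, ‖A (slice e ψ j)‖ ^ 2) := by
    have := h1.hasSum
    rwa [h1.tsum_prod, tsum_congr fun j => (norm_sq_eq (A (slice e ψ j))).symm] at this
  have h3 : HasSum (fun k => ‖A (slice e ψ (e k).2) (e k).1‖ ^ 2)
      (∑' j, ‖A (slice e ψ j)‖ ^ 2) :=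
    (Equiv.hasSum_iff (f := fun p : J × I => ‖A (slice e ψ p.1) p.2‖ ^ 2)
      (e.trans (Equiv.prodComm I J))).2 h2
  refine ⟨_, ?_, h3⟩
  rw [mul_pow]
  exact hasSum_le hle hs.hasSum ((hasSum_slice e ψ).mul_left (‖A‖ ^ 2))

/-- The operator `A ⊗ I` on `ℓ²(K, ℂ)`, for an operator `A` on `ℓ²(I, ℂ)` and `K ≃ I × J`. -/
def amp (e : K ≃ I × J) (A : ℓ²(I, ℂ) →L[ℂ] ℓ²(I, ℂ)) : ℓ²(K, ℂ) →L[ℂ] ℓ²(K, ℂ) :=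
  LinearMap.mkContinuous
    { toFun := fun ψ => ⟨fun k => A (slice e ψ (e k).2) (e k).1,
        memℓp_of_sq (hasSum_amp e A ψ).choose_spec.2.summable⟩
      map_add' := fun ψ φ => by
        ext k
        have : slice e (ψ + φ) (e k).2 = slice e ψ (e k).2 + slice e φ (e k).2 := by
          ext i; simp
        simp only [this, map_add, lp.coeFn_add, Pi.add_apply]
      map_smul' := fun c ψ => by
        ext k
        have : slice e (c • ψ) (e k).2 = c • slice e ψ (e k).2 := by
          ext i; simp
        simp [this] }
    ‖A‖ (fun ψ => by
      obtain ⟨s, hs, hsum⟩ := hasSum_amp e A ψ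
      refine le_of_sq_le_sq ?_ (by positivity)
      rw [norm_sq_eq]
      exact (le_of_eq hsum.tsum_eq).trans hs)

@[simp] theorem amp_apply (e : K ≃ I × J) (A : ℓ²(I, ℂ) →L[ℂ] ℓ²(I, ℂ)) (ψ : ℓ²(K, ℂ)) (k : K) :
    amp e A ψ k = A (slice e ψ (e k).2) (e k).1 := rfl

/-- The elementary tensor `φ ⊗ χ` in `ℓ²(K, ℂ)`, `K ≃ I × J`. -/
def tmul (e : K ≃ I × J) (φ : ℓ²(I, ℂ)) (χ : ℓ²(J, ℂ)) : ℓ²(K, ℂ) :=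
  ⟨fun k => φ (e k).1 * χ (e k).2, memℓp_of_sq (by
    have h := (summable_sq φ).mul_of_nonneg (summable_sq χ) (fun _ => by positivity)
      (fun _ => by positivity)
    have h' := e.summable_iff.2 h
    refine h'.congr fun k => ?_
    simp [mul_pow])⟩

@[simp] theorem tmul_apply (e : K ≃ I × J) (φ : ℓ²(I, ℂ)) (χ : ℓ²(J, ℂ)) (k : K) :
    tmul e φ χ k = φ (e k).1 * χ (e k).2 := rfl

/-- `(A ⊗ I)(φ ⊗ χ) = (A φ) ⊗ χ`. -/
theorem amp_tmul (e : K ≃ I × J) (A : ℓ²(I, ℂ) →L[ℂ] ℓ²(I, ℂ)) (φ : ℓ²(I, ℂ)) (χ : ℓ²(J, ℂ)) :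
    amp e A (tmul e φ χ) = tmul e (A φ) χ := by
  ext k
  have : slice e (tmul e φ χ) (e k).2 = χ (e k).2 • φ := by
    ext i; simp [mul_comm]
  simp [this, mul_comm]

end Ampliation

/-! ### Families of Hilbert spaces and their Hilbert tensor products -/

section Tensor

variable {Ω : Type*} (H : Ω → Type*) [∀ x, NormedAddCommGroup (H x)]
  [∀ x, InnerProductSpace ℂ (H x)] [∀ x, CompleteSpace (H x)]

/-- The index set of a Hilbert basis of `H x`. -/
def SiteIndex (x : Ω) : Type _ := ((exists_hilbertBasis ℂ (H x)).choose : Set (H x))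

/-- A Hilbert basis of `H x`. -/
def siteBasis (x : Ω) : HilbertBasis (SiteIndex H x) ℂ (H x) :=
  (exists_hilbertBasis ℂ (H x)).choose_spec.choose

/-- The product basis of the tensor product over `Λ` is indexed by the configurations on `Λ`. -/
abbrev Config (Λ : Finset Ω) : Type _ := ∀ x : Λ, SiteIndex H x

/-- The Hilbert space `⨂_{x ∈ Λ} H x`, in the coordinates of a product basis. That this is the
Hilbert tensor product, with `tprod` as its elementary tensors, is `inner_tprod` together with
`dense_span_tprod`; these two facts determine the tensor product up to a unique unitary. -/
abbrev TensorSpace (Λ : Finset Ω) : Type _ := ℓ²(Config H Λ, ℂ)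

/-- The observables on `Λ`: all bounded operators on `⨂_{x ∈ Λ} H x`, with the operator norm. -/
abbrev Observable (Λ : Finset Ω) : Type _ := TensorSpace H Λ →L[ℂ] TensorSpace H Λ

open Classical in
/-- A configuration on `Λ ⊇ X` is a configuration on `X` and one on `Λ \ X`. -/
def configSplit {X Λ : Finset Ω} (hX : X ⊆ Λ) :
    Config H Λ ≃ Config H X × Config H (Λ \ X) where
  toFun σ := (fun x => σ ⟨x, hX x.2⟩, fun x => σ ⟨x, (Finset.mem_sdiff.1 x.2).1⟩)
  invFun p := fun x => if hx : (x : Ω) ∈ X then p.1 ⟨x, hx⟩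
    else p.2 ⟨x, Finset.mem_sdiff.2 ⟨x.2, hx⟩⟩
  left_inv σ := by
    funext x
    by_cases hx : (x : Ω) ∈ X <;> simp [hx]
  right_inv p := by
    refine Prod.ext ?_ ?_
    · funext x
      simp
    · funext x
      have := (Finset.mem_sdiff.1 x.2).2
      simp [this]

/-- The embedding of the observables on `X` into the observables on `Λ ⊇ X`, `A ↦ A ⊗ I`. -/
def embed {X Λ : Finset Ω} (hX : X ⊆ Λ) (A : Observable H X) : Observable H Λ :=
  amp (configSplit H hX) A

variable {H}

theorem hasSum_pi_prod {κ : Type*} [Fintype κ] {ι : κ → Type*} {f : ∀ k, ι k → ℂ}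
    (hf : ∀ k, Summable fun i => ‖f k i‖) :
    HasSum (fun σ : ∀ k, ι k => ∏ k, f k (σ k)) (∏ k, ∑' i, f k i) := by
  classical
  have hsum : Summable fun σ : ∀ k, ι k => ∏ k, f k (σ k) := by
    refine Summable.of_norm (summable_of_sum_le (c := ∏ k, ∑' i, ‖f k i‖)
      (fun _ => norm_nonneg _) fun s => ?_)
    calc ∑ σ ∈ s, ‖∏ k, f k (σ k)‖
        ≤ ∑ σ ∈ Fintype.piFinset fun k => s.image fun σ => σ k, ‖∏ k, f k (σ k)‖ := by
          refine Finset.sum_le_sum_of_subset_of_nonneg (fun σ hσ => ?_)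
            fun _ _ _ => norm_nonneg _
          exact Fintype.mem_piFinset.2 fun k => Finset.mem_image_of_mem _ hσ
      _ = ∏ k, ∑ i ∈ s.image fun σ => σ k, ‖f k i‖ := by
          rw [Finset.prod_univ_sum]
          simp only [norm_prod]
      _ ≤ ∏ k, ∑' i, ‖f k i‖ := by
          refine Finset.prod_le_prod (fun k _ => Finset.sum_nonneg fun _ _ => norm_nonneg _)
            fun k _ => (hf k).sum_le_tsum _ fun _ _ => norm_nonneg _
  have h1 : Filter.Tendsto (fun s : ∀ k, Finset (ι k) => Fintype.piFinset s)
      Filter.atTop Filter.atTop := by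
    refine Filter.tendsto_atTop.2 fun t => ?_
    filter_upwards [Filter.eventually_ge_atTop fun k => t.image fun σ => σ k] with s hs σ hσ
    exact Fintype.mem_piFinset.2 fun k => hs k (Finset.mem_image_of_mem _ hσ)
  have h2 := hsum.hasSum.comp h1
  have h3 : Filter.Tendsto (fun s : ∀ k, Finset (ι k) => ∏ k, ∑ i ∈ s k, f k i)
      Filter.atTop (nhds (∏ k, ∑' i, f k i)) := by
    refine tendsto_finsetProd _ fun k _ => ?_
    have h5 : Filter.Tendsto (fun t : Finset (ι k) => ∑ i ∈ t, f k i) Filter.atTop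
        (nhds (∑' i, f k i)) := (hf k).of_norm.hasSum
    have h6 : Filter.Tendsto (fun s : ∀ k, Finset (ι k) => s k) Filter.atTop Filter.atTop := by
      refine Filter.tendsto_atTop.2 fun t => ?_
      filter_upwards [Filter.eventually_ge_atTop (Function.update (fun _ => ∅) k t)] with s hs
      simpa using hs k
    exact h5.comp h6
  have h4 := tendsto_nhds_unique (h2.congr fun s => by
    simp only [Function.comp_apply, Finset.prod_univ_sum]) h3
  rw [← h4]
  exact hsum.hasSum

/-- The elementary tensor `⨂_{x ∈ Λ} u x`. -/
def tprod {Λ : Finset Ω} (u : ∀ x : Λ, H x) : TensorSpace H Λ :=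
  ⟨fun σ => ∏ x : Λ, (siteBasis H x).repr (u x) (σ x), memℓp_of_sq (by
    have h := (hasSum_pi_prod (κ := Λ)
      (f := fun x i => ((‖(siteBasis H x).repr (u x) i‖ ^ 2 : ℝ) : ℂ))
      (fun x => by simpa using summable_sq ((siteBasis H x).repr (u x)))).summable
    refine h.norm.congr fun σ => ?_
    simp [Finset.prod_pow])⟩

@[simp] theorem tprod_apply {Λ : Finset Ω} (u : ∀ x : Λ, H x) (σ : Config H Λ) :
    tprod u σ = ∏ x : Λ, (siteBasis H x).repr (u x) (σ x) := rfl

theorem inner_tprod {Λ : Finset Ω} (u w : ∀ x : Λ, H x) :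
    inner ℂ (tprod u) (tprod w) = ∏ x : Λ, inner ℂ (u x) (w x) := by
  have h := (hasSum_pi_prod (κ := Λ) (f := fun x i =>
    inner ℂ ((siteBasis H x).repr (u x) i) ((siteBasis H x).repr (w x) i))
    (fun x => (lp.summable_inner (𝕜 := ℂ) _ _).norm)).tsum_eq
  rw [lp.inner_eq_tsum]
  refine Eq.trans (tsum_congr fun σ => ?_) (h.trans (Finset.prod_congr rfl fun x _ => ?_))
  · simp [Finset.prod_mul_distrib]
  · rw [← lp.inner_eq_tsum, LinearIsometryEquiv.inner_map_map]

theorem dense_span_tprod (Λ : Finset Ω) :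
    (Submodule.span ℂ (Set.range (tprod (H := H) (Λ := Λ)))).topologicalClosure = ⊤ := by
  classical
  let b : HilbertBasis (Config H Λ) ℂ (TensorSpace H Λ) := ⟨LinearIsometryEquiv.refl ℂ _⟩
  rw [eq_top_iff, ← b.dense_span]
  refine Submodule.topologicalClosure_mono (Submodule.span_mono ?_)
  rintro _ ⟨σ, rfl⟩
  refine ⟨fun x => siteBasis H x (σ x), ?_⟩
  ext ρ
  have hb : (b σ : TensorSpace H Λ) = lp.single 2 σ 1 := by
    rw [← b.repr_symm_single]; rfl
  rw [hb, tprod_apply]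
  simp only [HilbertBasis.repr_self, lp.single_apply, Pi.single_apply]
  by_cases hρ : ρ = σ
  · subst hρ; simp
  · obtain ⟨x, hx⟩ := Function.ne_iff.1 hρ
    rw [if_neg hρ]
    exact Finset.prod_eq_zero (Finset.mem_univ x) (if_neg hx)

open Classical in
/-- `⨂_{x ∈ Λ} u x = (⨂_{x ∈ X} u x) ⊗ (⨂_{x ∈ Λ \ X} u x)`; with `amp_tmul` this shows that
`embed` is `A ↦ A ⊗ I`. -/
theorem tprod_eq_tmul {X Λ : Finset Ω} (hX : X ⊆ Λ) (u : ∀ x : Λ, H x) :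
    tprod u = tmul (configSplit H hX) (tprod fun x : X => u ⟨x, hX x.2⟩)
      (tprod fun x : (Λ \ X : Finset Ω) => u ⟨x, (Finset.mem_sdiff.1 x.2).1⟩) := by
  ext σ
  rw [tmul_apply, tprod_apply, tprod_apply, tprod_apply]
  let F : Ω → ℂ := fun x =>
    if hx : x ∈ Λ then (siteBasis H x).repr (u ⟨x, hx⟩) (σ ⟨x, hx⟩) else 1
  have h1 : ∏ x : Λ, (siteBasis H x).repr (u x) (σ x) = ∏ x ∈ Λ, F x := by
    rw [← Finset.prod_coe_sort Λ F]
    exact Finset.prod_congr rfl fun x _ => by simp [F]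
  have h2 : ∏ x : X, (siteBasis H x).repr (u ⟨x, hX x.2⟩) ((configSplit H hX σ).1 x)
      = ∏ x ∈ X, F x := by
    rw [← Finset.prod_coe_sort X F]
    exact Finset.prod_congr rfl fun x _ => by simp [F, hX x.2, configSplit]
  have h3 : ∏ x : (Λ \ X : Finset Ω), (siteBasis H x).repr
      (u ⟨x, (Finset.mem_sdiff.1 x.2).1⟩) ((configSplit H hX σ).2 x) = ∏ x ∈ Λ \ X, F x := by
    rw [← Finset.prod_coe_sort (Λ \ X) F]
    exact Finset.prod_congr rfl fun x _ => by
      simp [F, (Finset.mem_sdiff.1 x.2).1, configSplit]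
  rw [h1, h2, h3, mul_comm, Finset.prod_sdiff hX]

end Tensor

/-! ### Hamiltonian, time evolution and the assumption on the interaction -/

section Dynamics

variable {Ω : Type*} {H : Ω → Type*} [∀ x, NormedAddCommGroup (H x)]
  [∀ x, InnerProductSpace ℂ (H x)] [∀ x, CompleteSpace (H x)]

/-- The Hamiltonian `H_Λ = ∑_{Z ⊆ Λ} h_Z` on `⨂_{x ∈ Λ} H x`. -/
def hamiltonian (h : ∀ Z : Finset Ω, Observable H Z) (Λ : Finset Ω) : Observable H Λ :=
  ∑ Z ∈ Λ.powerset.attach, embed H (Finset.mem_powerset.1 Z.2) (h Z)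

/-- The time evolution `τ_{t,Λ}(A) = e^{i t H_Λ} A e^{-i t H_Λ}`. -/
def evolve (h : ∀ Z : Finset Ω, Observable H Z) (Λ : Finset Ω) (t : ℝ) (A : Observable H Λ) :
    Observable H Λ :=
  NormedSpace.exp ((Complex.I * (t : ℂ)) • hamiltonian h Λ) * A *
    NormedSpace.exp ((-(Complex.I * (t : ℂ))) • hamiltonian h Λ)

/-- `𝒞₀ = sup_x ∑_y ∑_{Z ∋ x, y} ‖h_Z‖`, as an element of `[0, ∞]`. -/
def couplingConst (h : ∀ Z : Finset Ω, Observable H Z) : ℝ≥0∞ :=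
  ⨆ x : Ω, ∑' y : Ω, ∑' Z : {Z : Finset Ω // x ∈ Z ∧ y ∈ Z}, ‖h Z‖ₑ

/-- The assumption on the interaction `h` with the tail function `f`. The requirement that `f` is
nonnegative is implied by the tail bound (if there is a site at all); it is spelled out because
`ENNReal.ofReal` sends negative numbers to `0`. -/
structure AssumptionA [MetricSpace Ω] (h : ∀ Z : Finset Ω, Observable H Z) (f : ℝ → ℝ) :
    Prop where
  antitone : AntitoneOn f (Set.Ici 0)
  nonneg : ∀ R, 0 ≤ R → 0 ≤ f R
  tail : ∀ R, 0 ≤ R →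
    (⨆ x : Ω, ∑' Z : {Z : Finset Ω // x ∈ Z ∧ R ≤ Metric.diam (Z : Set Ω)}, ‖h Z‖ₑ)
      ≤ ENNReal.ofReal (f R)
  finite : couplingConst h < ∞

/-- `d(X, Y) = min {d(x, y) | x ∈ X, y ∈ Y}` (with value `0` if `X` or `Y` is empty). -/
def setDist [MetricSpace Ω] (X Y : Finset Ω) : ℝ :=
  sInf (Set.image2 dist (X : Set Ω) (Y : Set Ω))

end Dynamics

end QSpin

end

namespace QSpin

/-! ### Heisenberg dynamics in a C⋆-algebra -/

section Heisenberg

variable {𝔸 : Type*} [NormedRing 𝔸]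

/-! Split the interaction at range `R`. The commutator for the full dynamics is at most the one for
the truncated dynamics plus `2‖B‖` times the distance of the two evolved copies of `A`.

For the truncated dynamics, use the weight `w(x) = e^{-d(x,Y)/R}`. Two sites of a set of diameter
less than `R` have weights within a factor `e`, so summing `‖h_Z‖ ∑_{z ∈ Z} w(z)` over the truncated
terms through `x` gives at most `e 𝒞₀ w(x)` (`sum_truncate_weight_le`). Duhamel's formula, comparing
the dynamics with the one that omits all terms meeting `X`, bounds a commutator by its value at time
zero plus commutators with local terms `h_Z`, `Z` meeting `X`. Iterating gives `e^{vt} ∑_{x ∈ X}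
w(x)` (`norm_lie_heis_le`); the factor 2 of a commutator turns `e 𝒞₀` into `v = 2e 𝒞₀`.

For the difference of the dynamics, Duhamel's formula leaves commutators of the truncated evolution
of `A` with the terms of diameter at least `R`. Terms that come within `r` of `X` get the trivial
bound, the others the bound just obtained (`norm_lie_localTerm_le`). Summing over sites, the tail
assumption supplies `f(R)`, the near sites `g(r)`, and the far sites a convergent sum over shells
(`sum_exp_neg_dist_le`). -/

theorem norm_lie_le (A B : 𝔸) : ‖⁅A, B⁆‖ ≤ 2 * ‖A‖ * ‖B‖ := by
  rw [Ring.lie_def]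
  linarith [norm_sub_le (A * B) (B * A), norm_mul_le A B, norm_mul_le B A, mul_comm ‖A‖ ‖B‖]

theorem norm_lie_comm (A B : 𝔸) : ‖⁅A, B⁆‖ = ‖⁅B, A⁆‖ := by
  rw [Ring.lie_def, Ring.lie_def, norm_sub_rev]

theorem norm_neg_lie (A B : 𝔸) : ‖⁅-A, B⁆‖ = ‖⁅A, B⁆‖ := by
  rw [Ring.lie_def, Ring.lie_def, ← norm_neg]
  congr 1
  noncomm_ring

theorem norm_lie_le_add_right (A B C : 𝔸) :
    ‖⁅A, B⁆‖ ≤ ‖⁅A, C⁆‖ + 2 * ‖A‖ * ‖B - C‖ := by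
  have : ⁅A, B⁆ = ⁅A, C⁆ + ⁅A, B - C⁆ := by
    simp only [Ring.lie_def]
    noncomm_ring
  rw [this]
  exact (norm_add_le _ _).trans (add_le_add le_rfl (norm_lie_le _ _))

theorem norm_sum_lie_le {ι : Type*} (S : Finset ι) (F : ι → 𝔸) (B : 𝔸) :
    ‖⁅∑ i ∈ S, F i, B⁆‖ ≤ ∑ i ∈ S, ‖⁅F i, B⁆‖ := by
  have : ⁅∑ i ∈ S, F i, B⁆ = ∑ i ∈ S, ⁅F i, B⁆ := by
    simp only [Ring.lie_def, Finset.sum_mul, Finset.mul_sum, Finset.sum_sub_distrib]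
  rw [this]
  exact norm_sum_le _ _

variable [NormedAlgebra ℂ 𝔸]

/-- The unitary group `e^{i t H}`. -/
noncomputable def expI (H : 𝔸) (t : ℝ) : 𝔸 := NormedSpace.exp ((Complex.I * (t : ℂ)) • H)

/-- The conjugation `e^{i t H} A e^{-i t H}`. -/
noncomputable def heis (H : 𝔸) (t : ℝ) (A : 𝔸) : 𝔸 := expI H t * A * expI H (-t)

@[simp] theorem expI_zero (H : 𝔸) : expI H 0 = 1 := by
  simp [expI]

theorem heis_sub (H : 𝔸) (t : ℝ) (A B : 𝔸) : heis H t (A - B) = heis H t A - heis H t B := by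
  simp only [heis]; noncomm_ring

theorem heis_neg_left (H : 𝔸) (t : ℝ) (A : 𝔸) : heis (-H) t A = heis H (-t) A := by
  simp [heis, expI]

variable [CompleteSpace 𝔸]

theorem expI_neg_mul_expI (H : 𝔸) (t : ℝ) : expI H (-t) * expI H t = 1 := by
  let _ : NormedAlgebra ℚ 𝔸 := NormedAlgebra.restrictScalars ℚ ℂ 𝔸
  unfold expI
  rw [← NormedSpace.exp_add_of_commute]
  · simp
  · exact ((Commute.refl H).smul_left _).smul_right _

theorem expI_mul_expI_neg (H : 𝔸) (t : ℝ) : expI H t * expI H (-t) = 1 := by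
  simpa using expI_neg_mul_expI H (-t)

theorem heis_mul (H : 𝔸) (t : ℝ) (A B : 𝔸) : heis H t (A * B) = heis H t A * heis H t B := by
  calc heis H t (A * B) = expI H t * A * 1 * B * expI H (-t) := by simp only [heis]; noncomm_ring
    _ = _ := by rw [← expI_neg_mul_expI H t]; simp only [heis]; noncomm_ring

theorem heis_lie (H : 𝔸) (t : ℝ) (A B : 𝔸) : heis H t ⁅A, B⁆ = ⁅heis H t A, heis H t B⁆ := by
  simp only [Ring.lie_def, heis_sub, heis_mul]

theorem heis_neg_heis (H : 𝔸) (t : ℝ) (A : 𝔸) : heis H (-t) (heis H t A) = A := by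
  calc heis H (-t) (heis H t A)
      = (expI H (-t) * expI H t) * A * (expI H (-t) * expI H (-(-t))) := by
        simp only [heis]; noncomm_ring
    _ = A := by rw [expI_neg_mul_expI, expI_mul_expI_neg, one_mul, mul_one]

theorem heis_heis_neg (H : 𝔸) (t : ℝ) (A : 𝔸) : heis H t (heis H (-t) A) = A := by
  simpa using heis_neg_heis H (-t) A

theorem heis_of_commute {H A : 𝔸} (h : Commute H A) (t : ℝ) : heis H t A = A := by
  let _ : NormedAlgebra ℚ 𝔸 := NormedAlgebra.restrictScalars ℚ ℂ 𝔸
  have : Commute (expI H t) A := (h.smul_left _).exp_left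
  rw [heis, this.eq, mul_assoc, expI_mul_expI_neg, mul_one]

theorem hasDerivAt_expI (H : 𝔸) (t : ℝ) :
    HasDerivAt (expI H) (expI H t * (Complex.I • H)) t := by
  have h1 := hasDerivAt_exp_smul_const (𝕂 := ℝ) (Complex.I • H) t
  have h2 : ∀ u : ℝ, (Complex.I * (u : ℂ)) • H = u • (Complex.I • H) := fun u => by
    rw [mul_comm, mul_smul, Complex.coe_smul]
  unfold expI
  simp only [h2]
  exact h1

theorem hasDerivAt_expI' (H : 𝔸) (t : ℝ) :
    HasDerivAt (expI H) ((Complex.I • H) * expI H t) t := by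
  let _ : NormedAlgebra ℚ 𝔸 := NormedAlgebra.restrictScalars ℚ ℂ 𝔸
  have : Commute (expI H t) (Complex.I • H) :=
    (((Commute.refl H).smul_left _).exp_left).smul_right _
  rw [← this.eq]
  exact hasDerivAt_expI H t

/-- The interaction picture: the two evolutions contribute their generators with opposite signs, so
only `H - K` survives. -/
theorem hasDerivAt_heis_heis (H K B : 𝔸) (t : ℝ) :
    HasDerivAt (fun s => heis K (-s) (heis H s B))
      (heis K (-t) (Complex.I • ⁅H - K, heis H t B⁆)) t := by
  have neg : ∀ {F : ℝ → 𝔸} {F' : 𝔸}, HasDerivAt F F' (-t) →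
      HasDerivAt (fun s => F (-s)) (-F') t := fun {F F'} hF => by
    have := hF.scomp t (hasDerivAt_neg t)
    rwa [neg_one_smul] at this
  -- For each exponential the derivative is written with the generator on the side facing `heis H t
  -- B`, so that the four terms assemble into one commutator.
  have h1 := neg (hasDerivAt_expI K (-t))
  have h2 := hasDerivAt_expI' H t
  have h3 := neg (hasDerivAt_expI H (-t))
  have h4 := hasDerivAt_expI' K t
  have h5 := (h1.mul (((h2.mul_const B).mul h3))).mul h4
  simp only [heis, neg_neg]
  refine h5.congr_deriv ?_
  simp only [Ring.lie_def, smul_sub, mul_sub, sub_mul, smul_mul_assoc, mul_smul_comm, mul_neg,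
    neg_mul, mul_add, add_mul, mul_assoc, Pi.mul_apply]
  abel

variable [StarRing 𝔸] [CStarRing 𝔸] [StarModule ℂ 𝔸]

theorem expI_mem_unitary {H : 𝔸} (hH : IsSelfAdjoint H) (t : ℝ) : expI H t ∈ unitary 𝔸 := by
  let _ : NormedAlgebra ℚ 𝔸 := NormedAlgebra.restrictScalars ℚ ℂ 𝔸
  refine NormedSpace.exp_mem_unitary_of_mem_skewAdjoint ?_
  rw [skewAdjoint.mem_iff]
  simp [star_smul, hH.star_eq]

theorem norm_heis {H : 𝔸} (hH : IsSelfAdjoint H) (t : ℝ) (A : 𝔸) : ‖heis H t A‖ = ‖A‖ := by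
  rw [heis, CStarRing.norm_mul_mem_unitary _ (expI_mem_unitary hH _),
    CStarRing.norm_mem_unitary_mul _ (expI_mem_unitary hH _)]

theorem norm_lie_heis {H : 𝔸} (hH : IsSelfAdjoint H) (t : ℝ) (A B : 𝔸) :
    ‖⁅heis H t A, B⁆‖ = ‖⁅A, heis H (-t) B⁆‖ := by
  rw [← norm_heis hH (-t), heis_lie, heis_neg_heis]

/-- Duhamel's estimate for the difference of two dynamics. -/
theorem norm_heis_sub_heis_le {H K : 𝔸} (hK : IsSelfAdjoint K) (B : 𝔸)
    {φ φ' : ℝ → ℝ} {t : ℝ} (ht : 0 ≤ t) (h0 : 0 ≤ φ 0) (hφ : ∀ s, HasDerivAt φ (φ' s) s)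
    (hle : ∀ s, 0 ≤ s → s ≤ t → ‖⁅H - K, heis H s B⁆‖ ≤ φ' s) :
    ‖heis H t B - heis K t B‖ ≤ φ t := by
  -- Subtracting `B` makes the curve vanish at time zero. A majorant with a known derivative
  -- replaces the integral, and conjugation by `heis K t`, an isometry, turns the result into the
  -- difference of the two evolutions.
  have hd := fun s => (hasDerivAt_heis_heis H K B s).sub_const B
  have key := image_norm_le_of_norm_deriv_right_le_deriv_boundary
    (f := fun s => heis K (-s) (heis H s B) - B) (a := 0) (b := t)
    (fun s _ => (hd s).continuousAt.continuousWithinAt)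
    (fun s _ => (hd s).hasDerivWithinAt) (B := φ) (B' := φ') (by simpa [heis] using h0) hφ
    (fun s hs => by
      rw [norm_heis hK, norm_smul, Complex.norm_I, one_mul]
      exact hle s hs.1 hs.2.le) (Set.right_mem_Icc.2 ht)
  rwa [← norm_heis hK t, heis_sub, heis_heis_neg] at key

end Heisenberg

/-! ### Properties of the embedding `A ↦ A ⊗ I` -/

section AmpliationProperties

variable {I J K : Type*}

theorem norm_amp_le (e : K ≃ I × J) (A : ℓ²(I, ℂ) →L[ℂ] ℓ²(I, ℂ)) : ‖amp e A‖ ≤ ‖A‖ :=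
  LinearMap.mkContinuous_norm_le _ (norm_nonneg _) _

theorem inner_eq_tsum_slice (e : K ≃ I × J) (ψ φ : ℓ²(K, ℂ)) :
    inner ℂ ψ φ = ∑' j, inner ℂ (slice e ψ j) (slice e φ j) := by
  have h1 : Summable fun k => inner ℂ (ψ k) (φ k) := lp.summable_inner (𝕜 := ℂ) ψ φ
  let e' : J × I ≃ K := (Equiv.prodComm J I).trans e.symm
  have h2 := (e'.summable_iff (f := fun k => inner ℂ (ψ k) (φ k))).2 h1
  rw [lp.inner_eq_tsum, ← e'.tsum_eq]
  refine (Summable.tsum_prod h2).trans (tsum_congr fun j => ?_)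
  rw [lp.inner_eq_tsum]
  rfl

theorem slice_amp (e : K ≃ I × J) (A : ℓ²(I, ℂ) →L[ℂ] ℓ²(I, ℂ)) (ψ : ℓ²(K, ℂ)) (j : J) :
    slice e (amp e A ψ) j = A (slice e ψ j) := by
  ext i
  simp

/-- The inner product is the sum over slices, and `A ⊗ I` acts on every slice as `A`, so symmetry is
inherited slice by slice. -/
theorem isSelfAdjoint_amp (e : K ≃ I × J) {A : ℓ²(I, ℂ) →L[ℂ] ℓ²(I, ℂ)} (hA : IsSelfAdjoint A) :
    IsSelfAdjoint (amp e A) := by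
  rw [ContinuousLinearMap.isSelfAdjoint_iff_isSymmetric] at hA ⊢
  intro ψ φ
  have := fun j => hA (slice e ψ j) (slice e φ j)
  simp only [ContinuousLinearMap.coe_coe] at this ⊢
  simp only [inner_eq_tsum_slice e, slice_amp, this]

theorem amp_neg (e : K ≃ I × J) (A : ℓ²(I, ℂ) →L[ℂ] ℓ²(I, ℂ)) : amp e (-A) = -amp e A := by
  ext ψ k
  simp

theorem amp_zero (e : K ≃ I × J) : amp e (0 : ℓ²(I, ℂ) →L[ℂ] ℓ²(I, ℂ)) = 0 := by
  ext ψ k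
  simp

end AmpliationProperties

section EmbedProperties

variable {Ω : Type*} {H : Ω → Type*} [∀ x, NormedAddCommGroup (H x)]
  [∀ x, InnerProductSpace ℂ (H x)] [∀ x, CompleteSpace (H x)]

open Classical in
/-- An operator on `Y ⊆ Λ \ X` acts on the second factor of `φ ⊗ χ`. -/
theorem embed_tmul_right {X Y Λ : Finset Ω} (hX : X ⊆ Λ) (hY : Y ⊆ Λ) (hYX : Y ⊆ Λ \ X)
    (B : Observable H Y) (φ : TensorSpace H X) (χ : TensorSpace H (Λ \ X)) :
    embed H hY B (tmul (configSplit H hX) φ χ) =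
      tmul (configSplit H hX) φ (embed H hYX B χ) := by
  ext σ
  have key : slice (configSplit H hY) (tmul (configSplit H hX) φ χ) (configSplit H hY σ).2 =
      φ (configSplit H hX σ).1 •
        slice (configSplit H hYX) χ (configSplit H hYX (configSplit H hX σ).2).2 := by
    ext ρ
    simp only [slice_apply, tmul_apply, lp.coeFn_smul, Pi.smul_apply, smul_eq_mul]
    have h1 : (configSplit H hX ((configSplit H hY).symm (ρ, (configSplit H hY σ).2))).1 =
        (configSplit H hX σ).1 := by
      funext x
      have : (x : Ω) ∉ Y := fun h => (Finset.mem_sdiff.1 (hYX h)).2 x.2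
      simp [configSplit, this]
    have h2 : (configSplit H hX ((configSplit H hY).symm (ρ, (configSplit H hY σ).2))).2 =
        (configSplit H hYX).symm (ρ, (configSplit H hYX (configSplit H hX σ).2).2) := by
      funext x
      by_cases hx : (x : Ω) ∈ Y <;> simp [configSplit, hx]
    rw [h1, h2]
  rw [embed, amp_apply, key, map_smul]
  simp [embed, configSplit]

/-- On elementary tensors the two operators act on different factors; these tensors span a dense
subspace, and both products are continuous. -/
theorem commute_embed {X Y Λ : Finset Ω} (hX : X ⊆ Λ) (hY : Y ⊆ Λ) (hd : Disjoint X Y)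
    (A : Observable H X) (B : Observable H Y) : Commute (embed H hX A) (embed H hY B) := by
  classical
  have hYX : Y ⊆ Λ \ X := Finset.subset_sdiff.2 ⟨hY, hd.symm⟩
  refine ContinuousLinearMap.ext_on (Submodule.dense_iff_topologicalClosure_eq_top.2
    (dense_span_tprod (H := H) Λ)) ?_
  rintro _ ⟨u, rfl⟩
  rw [tprod_eq_tmul hX]
  change embed H hX A (embed H hY B _) = embed H hY B (embed H hX A _)
  rw [embed_tmul_right hX hY hYX]
  simp only [embed, amp_tmul]
  have := embed_tmul_right hX hY hYX B (A (tprod fun x : X => u ⟨x, hX x.2⟩))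
    (tprod fun x : (Λ \ X : Finset Ω) => u ⟨x, (Finset.mem_sdiff.1 x.2).1⟩)
  simpa only [embed] using this.symm

open Classical in
/-- The local term `h_Z` as an observable on `Λ`, or `0` if `Z ⊄ Λ`. -/
noncomputable def localTerm (h : ∀ Z : Finset Ω, Observable H Z) (Λ Z : Finset Ω) :
    Observable H Λ :=
  if hZ : Z ⊆ Λ then embed H hZ (h Z) else 0

theorem localTerm_of_subset (h : ∀ Z : Finset Ω, Observable H Z) {Λ Z : Finset Ω} (hZ : Z ⊆ Λ) :
    localTerm h Λ Z = embed H hZ (h Z) := dif_pos hZ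

theorem hamiltonian_eq_sum (h : ∀ Z : Finset Ω, Observable H Z) (Λ : Finset Ω) :
    hamiltonian h Λ = ∑ Z ∈ Λ.powerset, localTerm h Λ Z := by
  rw [hamiltonian, ← Finset.sum_attach Λ.powerset]
  exact Finset.sum_congr rfl fun Z _ => (localTerm_of_subset h (Finset.mem_powerset.1 Z.2)).symm

theorem isSelfAdjoint_localTerm {h : ∀ Z : Finset Ω, Observable H Z}
    (hs : ∀ Z, IsSelfAdjoint (h Z)) (Λ Z : Finset Ω) : IsSelfAdjoint (localTerm h Λ Z) := by
  unfold localTerm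
  split_ifs
  · exact isSelfAdjoint_amp _ (hs Z)
  · exact IsSelfAdjoint.zero _

theorem isSelfAdjoint_sum_localTerm {h : ∀ Z : Finset Ω, Observable H Z}
    (hs : ∀ Z, IsSelfAdjoint (h Z)) (Λ : Finset Ω) (S : Finset (Finset Ω)) :
    IsSelfAdjoint (∑ Z ∈ S, localTerm h Λ Z) :=
  isSelfAdjoint_sum _ fun Z _ => isSelfAdjoint_localTerm hs Λ Z

theorem hamiltonian_neg (h : ∀ Z : Finset Ω, Observable H Z) (Λ : Finset Ω) :
    hamiltonian (fun Z => -h Z) Λ = -hamiltonian h Λ := by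
  simp only [hamiltonian, embed, amp_neg, Finset.sum_neg_distrib]

theorem evolve_eq_heis (h : ∀ Z : Finset Ω, Observable H Z) (Λ : Finset Ω) (t : ℝ)
    (A : Observable H Λ) : evolve h Λ t A = heis (hamiltonian h Λ) t A := by
  simp [evolve, heis, expI]

end EmbedProperties

/-! ### The Lieb–Robinson bound for a weighted interaction -/

/-- A union bound, used to pass from sets meeting `X` to sets through a given site of `X`. -/
theorem sum_filter_le_sum_sum_filter {ι κ : Type*} (S : Finset κ) (T : Finset ι) (P : κ → Prop)
    (Q : ι → κ → Prop) [DecidablePred P] [∀ i, DecidablePred (Q i)] {f : κ → ℝ} (hf : ∀ k ∈ S, 0 ≤ f k)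
    (hPQ : ∀ k ∈ S, P k → ∃ i ∈ T, Q i k) :
    ∑ k ∈ S with P k, f k ≤ ∑ i ∈ T, ∑ k ∈ S with Q i k, f k := by
  simp only [Finset.sum_filter]
  rw [Finset.sum_comm]
  refine Finset.sum_le_sum fun k hk => ?_
  have h0 : ∀ i ∈ T, 0 ≤ if Q i k then f k else 0 := fun i _ => by
    split_ifs
    exacts [hf k hk, le_rfl]
  split_ifs with hP
  · obtain ⟨i, hi, hQ⟩ := hPQ k hk hP
    exact (if_pos hQ).ge.trans (Finset.single_le_sum h0 hi)
  · exact Finset.sum_nonneg h0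

/-- This majorant carries the induction over Duhamel iterations: the `-1` makes it vanish at time
zero and later cancels against the initial commutator, while the last summand integrates the
remainder of order `n` to that of order `n + 1`. -/
theorem hasDerivAt_duhamel_majorant (W b v σ s : ℝ) (n : ℕ) :
    HasDerivAt (fun s : ℝ => b * (W * (Real.exp (v * s) - 1) +
        (2 * σ * s) ^ (n + 1) / (n + 1).factorial))
      (b * (W * (Real.exp (v * s) * v) + 2 * σ * ((2 * σ * s) ^ n / n.factorial))) s := by
  have h1 : HasDerivAt (fun s : ℝ => Real.exp (v * s)) (Real.exp (v * s) * v) s := by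
    simpa using ((hasDerivAt_id s).const_mul v).exp
  have h2 : HasDerivAt (fun s : ℝ => (2 * σ * s) ^ (n + 1) / (n + 1).factorial)
      (2 * σ * ((2 * σ * s) ^ n / n.factorial)) s := by
    have := (((hasDerivAt_id s).const_mul (2 * σ)).pow (n + 1)).div_const
      ((n + 1).factorial : ℝ)
    refine this.congr_deriv ?_
    simp only [Nat.factorial_succ, id, Nat.cast_mul, Nat.add_sub_cancel, mul_one]
    field_simp
  exact (((h1.sub_const 1).const_mul W).add h2).const_mul b

section LiebRobinson

variable {Ω : Type*} {H : Ω → Type*} [∀ x, NormedAddCommGroup (H x)]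
  [∀ x, InnerProductSpace ℂ (H x)] [∀ x, CompleteSpace (H x)]
  [DecidableEq Ω]

/-- Disjoint supports commute; otherwise a common site already contributes weight at least 1, so the
trivial bound suffices. -/
theorem norm_lie_embed_le {X Y Λ : Finset Ω} (hX : X ⊆ Λ) (hY : Y ⊆ Λ) {w : Ω → ℝ}
    (hw : ∀ x, 0 ≤ w x) (hwY : ∀ y ∈ Y, 1 ≤ w y) (A : Observable H X) (B : Observable H Y) :
    ‖⁅embed H hX A, embed H hY B⁆‖ ≤ 2 * ‖A‖ * ‖B‖ * ∑ x ∈ X, w x := by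
  have h0 : 0 ≤ ∑ x ∈ X, w x := Finset.sum_nonneg fun x _ => hw x
  by_cases hd : Disjoint X Y
  · rw [(commute_embed hX hY hd A B).lie_eq, norm_zero]
    positivity
  · obtain ⟨x, hxX, hxY⟩ := Finset.not_disjoint_iff.1 hd
    have h1 : 1 ≤ ∑ x ∈ X, w x :=
      (hwY x hxY).trans (Finset.single_le_sum (fun x _ => hw x) hxX)
    have hA : ‖embed H hX A‖ ≤ ‖A‖ := norm_amp_le _ A
    have hB : ‖embed H hY B‖ ≤ ‖B‖ := norm_amp_le _ B
    calc ‖⁅embed H hX A, embed H hY B⁆‖ ≤ 2 * ‖embed H hX A‖ * ‖embed H hY B‖ := norm_lie_le _ _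
      _ ≤ 2 * ‖A‖ * ‖B‖ * 1 := by rw [mul_one]; gcongr
      _ ≤ _ := by gcongr

/-- One application of Duhamel's formula to the observable evolving under the Hamiltonian and under
the Hamiltonian without the terms that meet `X`. -/
theorem norm_lie_heis_le_of_deriv {h : ∀ Z : Finset Ω, Observable H Z}
    (hs : ∀ Z, IsSelfAdjoint (h Z)) {Λ X : Finset Ω} (hX : X ⊆ Λ) (A : Observable H X)
    (B : Observable H Λ) {φ φ' : ℝ → ℝ} {t : ℝ} (ht : 0 ≤ t) (h0 : 0 ≤ φ 0)
    (hφ : ∀ s, HasDerivAt φ (φ' s) s)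
    (hle : ∀ s, 0 ≤ s → s ≤ t → ∑ Z ∈ Λ.powerset with ¬Disjoint Z X,
      ‖⁅localTerm h Λ Z, heis (hamiltonian h Λ) s B⁆‖ ≤ φ' s) :
    ‖⁅embed H hX A, heis (hamiltonian h Λ) t B⁆‖ ≤
      ‖⁅embed H hX A, B⁆‖ + 2 * ‖A‖ * φ t := by
  set HK := ∑ Z ∈ Λ.powerset with Disjoint Z X, localTerm h Λ Z with hHK
  have hKself : IsSelfAdjoint HK := isSelfAdjoint_sum_localTerm hs _ _
  have hdiff : hamiltonian h Λ - HK = ∑ Z ∈ Λ.powerset with ¬Disjoint Z X, localTerm h Λ Z := by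
    rw [hamiltonian_eq_sum, hHK, ← Finset.sum_filter_add_sum_filter_not Λ.powerset
      (fun Z => Disjoint Z X), add_sub_cancel_left]
  have hcomm : Commute HK (embed H hX A) := by
    refine Commute.sum_left _ _ _ fun Z hZ => ?_
    obtain ⟨hZ1, hZ2⟩ := Finset.mem_filter.1 hZ
    rw [localTerm_of_subset h (Finset.mem_powerset.1 hZ1)]
    exact commute_embed _ _ hZ2 _ _
  have hduh : ‖heis (hamiltonian h Λ) t B - heis HK t B‖ ≤ φ t :=
    norm_heis_sub_heis_le hKself B ht h0 hφ fun s hs0 hst => by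
      rw [hdiff]
      exact (norm_sum_lie_le _ _ _).trans (hle s hs0 hst)
  have hA : ‖embed H hX A‖ ≤ ‖A‖ := norm_amp_le _ A
  -- The reduced dynamics is an isometric automorphism fixing `A`, so it drops out of the
  -- commutator.
  have hfix : ‖⁅embed H hX A, heis HK t B⁆‖ = ‖⁅embed H hX A, B⁆‖ := by
    have := norm_heis hKself t ⁅embed H hX A, B⁆
    rwa [heis_lie, heis_of_commute hcomm] at this
  refine (norm_lie_le_add_right _ _ (heis HK t B)).trans ?_
  rw [hfix]
  gcongr

/-- The Lieb–Robinson bound after `n` iterations of Duhamel's formula. -/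
theorem norm_lie_heis_le_add {h : ∀ Z : Finset Ω, Observable H Z} (hs : ∀ Z, IsSelfAdjoint (h Z))
    {Λ Y : Finset Ω} (hY : Y ⊆ Λ) {w : Ω → ℝ} {v : ℝ} (hw : ∀ x, 0 ≤ w x)
    (hwY : ∀ y ∈ Y, 1 ≤ w y)
    (hsite : ∀ x ∈ Λ, ∑ Z ∈ Λ.powerset with x ∈ Z, ‖h Z‖ * ∑ z ∈ Z, w z ≤ v / 2 * w x)
    (B : Observable H Y) (n : ℕ) :
    ∀ (X : Finset Ω) (hX : X ⊆ Λ) (A : Observable H X) (t : ℝ), 0 ≤ t →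
      ‖⁅embed H hX A, heis (hamiltonian h Λ) t (embed H hY B)⁆‖ ≤
        2 * ‖A‖ * ‖B‖ * (Real.exp (v * t) * ∑ x ∈ X, w x +
          (2 * (∑ Z ∈ Λ.powerset, ‖h Z‖) * t) ^ n / n.factorial) := by
  have hself : IsSelfAdjoint (hamiltonian h Λ) := by
    rw [hamiltonian_eq_sum]
    exact isSelfAdjoint_sum_localTerm hs _ _
  set σ := ∑ Z ∈ Λ.powerset, ‖h Z‖ with hσ
  have hσ0 : 0 ≤ σ := Finset.sum_nonneg fun _ _ => norm_nonneg _
  have hW0 : ∀ X : Finset Ω, 0 ≤ ∑ x ∈ X, w x := fun X => Finset.sum_nonneg fun x _ => hw x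
  induction n with
  | zero =>
    intro X hX A t ht
    have hA : ‖embed H hX A‖ ≤ ‖A‖ := norm_amp_le _ A
    have hB : ‖embed H hY B‖ ≤ ‖B‖ := norm_amp_le _ B
    calc _ ≤ 2 * ‖embed H hX A‖ * ‖heis (hamiltonian h Λ) t (embed H hY B)‖ := norm_lie_le _ _
      _ ≤ 2 * ‖A‖ * ‖B‖ * 1 := by rw [norm_heis hself, mul_one]; gcongr
      _ ≤ _ := by
        have := mul_nonneg (Real.exp_pos (v * t)).le (hW0 X)
        gcongr
        simpa using this
  | succ n ih =>
    intro X hX A t ht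
    have hweight : ∑ Z ∈ Λ.powerset with ¬Disjoint Z X, ‖h Z‖ * ∑ z ∈ Z, w z ≤
        v / 2 * ∑ x ∈ X, w x := by
      refine (sum_filter_le_sum_sum_filter Λ.powerset X (fun Z => ¬Disjoint Z X)
        (fun x Z => x ∈ Z) (f := fun Z => ‖h Z‖ * ∑ z ∈ Z, w z)
        (fun Z _ => mul_nonneg (norm_nonneg _) (hW0 Z)) fun Z _ hZ => ?_).trans ?_
      · obtain ⟨x, hx, hx'⟩ := Finset.not_disjoint_iff.1 hZ
        exact ⟨x, hx', hx⟩
      · rw [Finset.mul_sum]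
        exact Finset.sum_le_sum fun x hx => hsite x (hX hx)
    have hσle : ∑ Z ∈ Λ.powerset with ¬Disjoint Z X, ‖h Z‖ ≤ σ :=
      Finset.sum_le_sum_of_subset_of_nonneg (Finset.filter_subset _ _) fun _ _ _ => norm_nonneg _
    clear_value σ
    have key := norm_lie_heis_le_of_deriv hs hX A (embed H hY B) ht (by simp)
      (fun s => hasDerivAt_duhamel_majorant (∑ x ∈ X, w x) ‖B‖ v σ s n) fun s hs0 _ => by
        have hr : 0 ≤ (2 * σ * s) ^ n / n.factorial := by positivity
        calc _ ≤ ∑ Z ∈ Λ.powerset with ¬Disjoint Z X, (2 * ‖B‖ * Real.exp (v * s) *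
                (‖h Z‖ * ∑ z ∈ Z, w z) + 2 * ‖B‖ * ((2 * σ * s) ^ n / n.factorial) * ‖h Z‖) := by
              refine Finset.sum_le_sum fun Z hZ => ?_
              have hZΛ := Finset.mem_powerset.1 (Finset.mem_filter.1 hZ).1
              rw [localTerm_of_subset h hZΛ]
              refine (ih Z hZΛ (h Z) s hs0).trans_eq ?_
              ring
          _ = 2 * ‖B‖ * Real.exp (v * s) *
                (∑ Z ∈ Λ.powerset with ¬Disjoint Z X, ‖h Z‖ * ∑ z ∈ Z, w z) +
              2 * ‖B‖ * ((2 * σ * s) ^ n / n.factorial) *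
                ∑ Z ∈ Λ.powerset with ¬Disjoint Z X, ‖h Z‖ := by
              rw [Finset.sum_add_distrib, Finset.mul_sum, Finset.mul_sum]
          _ ≤ 2 * ‖B‖ * Real.exp (v * s) * (v / 2 * ∑ x ∈ X, w x) +
              2 * ‖B‖ * ((2 * σ * s) ^ n / n.factorial) * σ := by
              gcongr
          _ = _ := by ring
    refine (key.trans (add_le_add (norm_lie_embed_le hX hY hw hwY A B) le_rfl)).trans_eq ?_
    ring

/-- The Lieb–Robinson bound with respect to a weight `w` for which the interaction is bounded. -/
theorem norm_lie_heis_le {h : ∀ Z : Finset Ω, Observable H Z} (hs : ∀ Z, IsSelfAdjoint (h Z))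
    {Λ X Y : Finset Ω} (hX : X ⊆ Λ) (hY : Y ⊆ Λ) {w : Ω → ℝ} {v : ℝ}
    (hw : ∀ x, 0 ≤ w x) (hwY : ∀ y ∈ Y, 1 ≤ w y)
    (hsite : ∀ x ∈ Λ, ∑ Z ∈ Λ.powerset with x ∈ Z, ‖h Z‖ * ∑ z ∈ Z, w z ≤ v / 2 * w x)
    (A : Observable H X) (B : Observable H Y) {t : ℝ} (ht : 0 ≤ t) :
    ‖⁅embed H hX A, heis (hamiltonian h Λ) t (embed H hY B)⁆‖ ≤
      2 * ‖A‖ * ‖B‖ * (Real.exp (v * t) * ∑ x ∈ X, w x) := by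
  -- For fixed `Λ` the total norm of the interaction is finite, so the remainder vanishes as the
  -- number of iterations grows.
  have := ((FloorSemiring.tendsto_pow_div_factorial_atTop
    (2 * (∑ Z ∈ Λ.powerset, ‖h Z‖) * t)).const_add
      (Real.exp (v * t) * ∑ x ∈ X, w x)).const_mul (2 * ‖A‖ * ‖B‖)
  rw [add_zero] at this
  exact ge_of_tendsto' this fun n => norm_lie_heis_le_add hs hY hw hwY hsite B n X hX A t ht

/-- The Lieb–Robinson bound with the first observable evolving. -/
theorem norm_lie_evolve_le {h : ∀ Z : Finset Ω, Observable H Z} (hs : ∀ Z, IsSelfAdjoint (h Z))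
    {Λ X Y : Finset Ω} (hX : X ⊆ Λ) (hY : Y ⊆ Λ) {w : Ω → ℝ} {v : ℝ}
    (hw : ∀ x, 0 ≤ w x) (hwY : ∀ y ∈ Y, 1 ≤ w y)
    (hsite : ∀ x ∈ Λ, ∑ Z ∈ Λ.powerset with x ∈ Z, ‖h Z‖ * ∑ z ∈ Z, w z ≤ v / 2 * w x)
    (A : Observable H X) (B : Observable H Y) {t : ℝ} (ht : 0 ≤ t) :
    ‖⁅heis (hamiltonian h Λ) t (embed H hX A), embed H hY B⁆‖ ≤
      2 * ‖A‖ * ‖B‖ * (Real.exp (v * t) * ∑ x ∈ X, w x) := by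
  have hself : IsSelfAdjoint (hamiltonian h Λ) := by
    rw [hamiltonian_eq_sum]
    exact isSelfAdjoint_sum_localTerm hs _ _
  -- Changing the sign of the interaction reverses time and keeps all norms; time invariance then
  -- moves the evolution to the other entry of the commutator.
  have key := norm_lie_heis_le (h := fun Z => -h Z) (fun Z => (hs Z).neg) hX hY hw hwY
    (by simpa using hsite) A B ht
  rwa [hamiltonian_neg, heis_neg_left, ← norm_lie_heis hself] at key

end LiebRobinson

/-! ### Growth of the lattice -/

theorem summable_rpow_mul_exp_neg (D : ℝ) :
    Summable fun k : ℕ => ((k : ℝ) + 3) ^ D * Real.exp (-k) := by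
  obtain ⟨n, hn⟩ := exists_nat_ge D
  have h1 := ((summable_nat_add_iff 3).2
    (Real.summable_pow_mul_exp_neg_nat_mul n one_pos)).mul_right (Real.exp 3)
  refine h1.of_nonneg_of_le (fun k => by positivity) fun k => ?_
  have h2 : ((k : ℝ) + 3) ^ D ≤ ((k : ℝ) + 3) ^ n := by
    rw [← Real.rpow_natCast]
    exact Real.rpow_le_rpow_of_exponent_le (by linarith [(Nat.cast_nonneg k : (0 : ℝ) ≤ k)]) hn
  rw [mul_assoc, ← Real.exp_add]
  push_cast
  rw [show -1 * ((k : ℝ) + 3) + 3 = -k by ring]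
  gcongr

theorem sum_exp_neg_dist_le {Ω : Type*} [MetricSpace Ω] {C D : ℝ} (hC : 0 < C) (hD : 0 < D)
    {x : Ω} (hcount : ∀ ρ : ℝ, 0 ≤ ρ → {y : Ω | dist x y ≤ ρ}.Finite ∧
      ({y : Ω | dist x y ≤ ρ}.ncard : ℝ) ≤ C * (1 + ρ) ^ D)
    (S : Finset Ω) {r R : ℝ} (hr : 0 ≤ r) (hR : 1 ≤ R) :
    ∑ y ∈ S with ¬dist x y ≤ r, Real.exp (-dist x y / R) ≤
      (C * ∑' k : ℕ, ((k : ℝ) + 3) ^ D * Real.exp (-k)) * max r R ^ D * Real.exp (-r / R) := by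
  have hR0 : 0 < R := by linarith
  set M := max r R with hM
  have hM1 : 1 ≤ M := hR.trans (le_max_right _ _)
  set T := S.filter fun y => ¬dist x y ≤ r with hT
  -- The far sites are sorted into shells of width `R` around the ball of radius `r`.
  let κ : Ω → ℕ := fun y => ⌊(dist x y - r) / R⌋₊
  have hterm : ∀ y ∈ T, Real.exp (-dist x y / R) ≤ Real.exp (-r / R) * Real.exp (-(κ y : ℝ)) := by
    intro y hy
    have hy' : r < dist x y := not_le.1 (Finset.mem_filter.1 hy).2
    have := Nat.floor_le (div_nonneg (sub_nonneg.2 hy'.le) hR0.le)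
    rw [← Real.exp_add, Real.exp_le_exp]
    have h2 : -dist x y / R = -r / R + -((dist x y - r) / R) := by ring
    rw [h2]
    gcongr
  have hcard : ∀ k : ℕ, (({y ∈ T | κ y = k}).card : ℝ) ≤ C * (((k : ℝ) + 3) ^ D * M ^ D) := by
    intro k
    have hρ : 0 ≤ r + (k + 1) * R := by positivity
    obtain ⟨hfin, hle⟩ := hcount _ hρ
    have h1 : ({y ∈ T | κ y = k}).card ≤ {y : Ω | dist x y ≤ r + (k + 1) * R}.ncard := by
      rw [← Set.ncard_coe_finset]
      refine Set.ncard_le_ncard (fun y hy => ?_) hfin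
      obtain ⟨-, hy⟩ := Finset.mem_filter.1 (Finset.mem_coe.1 hy)
      have := (Nat.lt_floor_add_one ((dist x y - r) / R)).le
      rw [show ⌊(dist x y - r) / R⌋₊ = k from hy, div_le_iff₀ hR0] at this
      simp only [Set.mem_ofPred_eq]
      linarith
    -- Each of `1`, `r` and `R` is at most `M`; the first uses `1 ≤ R`. This is the origin of the
    -- `3` in the series.
    have h2 : 1 + (r + (k + 1) * R) ≤ (k + 3) * M := by
      have h3 : r ≤ M := le_max_left _ _
      have h4 : ((k : ℝ) + 1) * R ≤ (k + 1) * M := by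
        gcongr
        exact le_max_right _ _
      linarith
    calc (({y ∈ T | κ y = k}).card : ℝ) ≤ C * (1 + (r + (k + 1) * R)) ^ D :=
          (Nat.cast_le.2 h1).trans hle
      _ ≤ C * (((k : ℝ) + 3) * M) ^ D := by gcongr
      _ = _ := by rw [Real.mul_rpow (by positivity) (by positivity)]
  calc ∑ y ∈ T, Real.exp (-dist x y / R)
      ≤ ∑ y ∈ T, Real.exp (-r / R) * Real.exp (-(κ y : ℝ)) := Finset.sum_le_sum hterm
    _ = Real.exp (-r / R) * ∑ k ∈ T.image κ, ({y ∈ T | κ y = k}).card • Real.exp (-(k : ℝ)) := by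
        rw [← Finset.mul_sum, Finset.sum_comp (fun k : ℕ => Real.exp (-(k : ℝ))) κ]
    _ ≤ Real.exp (-r / R) * ∑ k ∈ T.image κ,
          C * M ^ D * (((k : ℝ) + 3) ^ D * Real.exp (-(k : ℝ))) := by
        gcongr with k
        rw [nsmul_eq_mul]
        calc _ ≤ C * (((k : ℝ) + 3) ^ D * M ^ D) * Real.exp (-(k : ℝ)) := by
              gcongr
              exact hcard k
          _ = _ := by ring
    _ ≤ Real.exp (-r / R) * (C * M ^ D *
          ∑' k : ℕ, ((k : ℝ) + 3) ^ D * Real.exp (-(k : ℝ))) := by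
        rw [← Finset.mul_sum]
        gcongr
        exact (summable_rpow_mul_exp_neg D).sum_le_tsum _ fun k _ => by positivity
    _ = _ := by ring

/-! ### Finite sums of the interaction -/

section Interaction

variable {Ω : Type*} {H : Ω → Type*} [∀ x, NormedAddCommGroup (H x)]
  [∀ x, InnerProductSpace ℂ (H x)] [∀ x, CompleteSpace (H x)]

theorem ofReal_sum_norm_le_tsum {κ : Type*} {E : κ → Type*} [∀ k, NormedAddCommGroup (E k)]
    (a : ∀ k, E k) (S : Finset κ) (p : κ → Prop) [DecidablePred p] :
    ENNReal.ofReal (∑ k ∈ S with p k, ‖a k‖) ≤ ∑' k : {k // p k}, ‖a k‖ₑ := by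
  rw [ENNReal.ofReal_sum_of_nonneg fun _ _ => norm_nonneg _,
    ← Finset.sum_subtype_eq_sum_filter]
  simp only [ofReal_norm]
  exact ENNReal.sum_le_tsum _

/-- Double counting: the cardinality of `Z` is the number of sites `y` with `y ∈ Z`. -/
theorem sum_norm_mul_card_le [DecidableEq Ω] {h : ∀ Z : Finset Ω, Observable H Z}
    (hfin : couplingConst h < ∞) (Λ : Finset Ω) (x : Ω) :
    ∑ Z ∈ Λ.powerset with x ∈ Z, ‖h Z‖ * (Z.card : ℝ) ≤ (couplingConst h).toReal := by
  rw [← ENNReal.ofReal_le_iff_le_toReal hfin.ne]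
  have h1 : ∑ Z ∈ Λ.powerset with x ∈ Z, ‖h Z‖ * (Z.card : ℝ) =
      ∑ y ∈ Λ, ∑ Z ∈ Λ.powerset with x ∈ Z ∧ y ∈ Z, ‖h Z‖ := by
    simp only [← Finset.filter_filter, Finset.sum_filter (fun Z => _ ∈ Z)]
    rw [Finset.sum_comm]
    refine Finset.sum_congr rfl fun Z hZ => ?_
    have hZΛ : Z ⊆ Λ := Finset.mem_powerset.1 hZ
    split_ifs
    · rw [← Finset.sum_filter, Finset.filter_mem_eq_inter, Finset.inter_eq_right.2 hZΛ,
        Finset.sum_const, nsmul_eq_mul, mul_comm]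
    · simp
  rw [h1, ENNReal.ofReal_sum_of_nonneg fun _ _ => Finset.sum_nonneg fun _ _ => norm_nonneg _]
  calc _ ≤ ∑ y ∈ Λ, ∑' Z : {Z : Finset Ω // x ∈ Z ∧ y ∈ Z}, ‖h Z‖ₑ :=
        Finset.sum_le_sum fun y _ => ofReal_sum_norm_le_tsum h Λ.powerset fun Z => x ∈ Z ∧ y ∈ Z
    _ ≤ ∑' y : Ω, ∑' Z : {Z : Finset Ω // x ∈ Z ∧ y ∈ Z}, ‖h Z‖ₑ := ENNReal.sum_le_tsum _
    _ ≤ _ := le_iSup (fun x => ∑' y : Ω, ∑' Z : {Z : Finset Ω // x ∈ Z ∧ y ∈ Z}, ‖h Z‖ₑ) x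

theorem sum_norm_tail_le [DecidableEq Ω] [MetricSpace Ω] {h : ∀ Z : Finset Ω, Observable H Z}
    {f : ℝ → ℝ} (hA : AssumptionA h f) {R : ℝ} (hR : 0 ≤ R) (S : Finset (Finset Ω)) (x : Ω) :
    ∑ Z ∈ S with x ∈ Z ∧ R ≤ Metric.diam ((Z : Finset Ω) : Set Ω), ‖h Z‖ ≤ f R := by
  rw [← ENNReal.ofReal_le_ofReal_iff (hA.nonneg R hR)]
  refine le_trans ?_ ((le_iSup (fun x => ∑' Z : {Z : Finset Ω // x ∈ Z ∧
    R ≤ Metric.diam (Z : Set Ω)}, ‖h Z‖ₑ) x).trans (hA.tail R hR))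
  exact ofReal_sum_norm_le_tsum h S fun Z => x ∈ Z ∧ R ≤ Metric.diam (Z : Set Ω)

/-- The truncation of the interaction to sets of diameter less than `R`. -/
noncomputable def truncate [MetricSpace Ω] (h : ∀ Z : Finset Ω, Observable H Z) (R : ℝ) :
    ∀ Z : Finset Ω, Observable H Z :=
  fun Z => if Metric.diam (Z : Set Ω) < R then h Z else 0

theorem isSelfAdjoint_truncate [MetricSpace Ω] {h : ∀ Z : Finset Ω, Observable H Z}
    (hs : ∀ Z, IsSelfAdjoint (h Z)) (R : ℝ) (Z : Finset Ω) : IsSelfAdjoint (truncate h R Z) := by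
  unfold truncate
  split_ifs
  exacts [hs Z, IsSelfAdjoint.zero _]

theorem hamiltonian_sub_truncate [MetricSpace Ω] (h : ∀ Z : Finset Ω, Observable H Z) (R : ℝ)
    (Λ : Finset Ω) :
    hamiltonian h Λ - hamiltonian (truncate h R) Λ =
      ∑ Z ∈ Λ.powerset with R ≤ Metric.diam ((Z : Finset Ω) : Set Ω), localTerm h Λ Z := by
  rw [hamiltonian_eq_sum, hamiltonian_eq_sum, ← Finset.sum_sub_distrib, Finset.sum_filter]
  refine Finset.sum_congr rfl fun Z hZ => ?_
  rw [localTerm_of_subset _ (Finset.mem_powerset.1 hZ),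
    localTerm_of_subset _ (Finset.mem_powerset.1 hZ), truncate]
  by_cases hd : Metric.diam (Z : Set Ω) < R
  · simp [hd, not_le.2 hd]
  · simp [hd, not_lt.1 hd, embed, amp_zero]

/-- The truncated interaction is bounded with respect to the weight `e^{-d(·, Y) / R}`. -/
theorem sum_truncate_weight_le [DecidableEq Ω] [MetricSpace Ω]
    {h : ∀ Z : Finset Ω, Observable H Z} (hfin : couplingConst h < ∞) {v R : ℝ} (hR : 0 < R)
    (hv : 2 * Real.exp 1 * (couplingConst h).toReal ≤ v) (Λ : Finset Ω) (Y : Set Ω) (x : Ω) :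
    ∑ Z ∈ Λ.powerset with x ∈ Z, ‖truncate h R Z‖ *
        ∑ z ∈ Z, Real.exp (-Metric.infDist z Y / R) ≤
      v / 2 * Real.exp (-Metric.infDist x Y / R) := by
  set w := Real.exp (-Metric.infDist x Y / R) with hw
  calc _ ≤ ∑ Z ∈ Λ.powerset with x ∈ Z, (Real.exp 1 * w) * (‖h Z‖ * (Z.card : ℝ)) := by
        refine Finset.sum_le_sum fun Z hZ => ?_
        have hxZ := (Finset.mem_filter.1 hZ).2
        unfold truncate
        split_ifs with hd
        · have h1 : ∑ z ∈ Z, Real.exp (-Metric.infDist z Y / R) ≤ Z.card • (Real.exp 1 * w) := by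
            refine Finset.sum_le_card_nsmul _ _ _ fun z hz => ?_
            rw [hw, ← Real.exp_add, Real.exp_le_exp]
            -- Both sites lie in `Z`, of diameter less than `R`, so the exponent changes by at most
            -- 1.
            have h2 : dist x z ≤ R :=
              (Metric.dist_le_diam_of_mem Z.finite_toSet.isBounded hxZ hz).trans hd.le
            have h3 := Metric.infDist_le_infDist_add_dist (s := Y) (x := x) (y := z)
            rw [div_le_iff₀ hR, add_mul, div_mul_cancel₀ _ hR.ne']
            linarith
          rw [nsmul_eq_mul] at h1
          calc _ ≤ ‖h Z‖ * (Z.card * (Real.exp 1 * w)) := by gcongr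
            _ = _ := by ring
        · rw [norm_zero, zero_mul]
          positivity
    _ ≤ (Real.exp 1 * w) * (couplingConst h).toReal := by
        rw [← Finset.mul_sum]
        gcongr
        exact sum_norm_mul_card_le hfin Λ x
    _ ≤ v / 2 * w := by
        have : Real.exp 1 * (couplingConst h).toReal ≤ v / 2 := by linarith
        calc _ = Real.exp 1 * (couplingConst h).toReal * w := by ring
          _ ≤ _ := by gcongr

/-- The Lieb–Robinson bound for the truncated interaction. -/
theorem norm_lie_heis_truncate_le [MetricSpace Ω] {h : ∀ Z : Finset Ω, Observable H Z}
    (hs : ∀ Z, IsSelfAdjoint (h Z)) (hfin : couplingConst h < ∞) {v R : ℝ} (hR : 0 < R)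
    (hv : 2 * Real.exp 1 * (couplingConst h).toReal ≤ v) {Λ X Y : Finset Ω} (hX : X ⊆ Λ)
    (hY : Y ⊆ Λ) (A : Observable H X) (B : Observable H Y) {t : ℝ} (ht : 0 ≤ t) :
    ‖⁅heis (hamiltonian (truncate h R) Λ) t (embed H hX A), embed H hY B⁆‖ ≤
      2 * ‖A‖ * ‖B‖ * (Real.exp (v * t) * ∑ x ∈ X, Real.exp (-Metric.infDist x (Y : Set Ω) / R)) := by
  classical
  refine norm_lie_evolve_le (isSelfAdjoint_truncate hs R) hX hY (fun x => (Real.exp_pos _).le)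
    (fun y hy => ?_) (fun x _ => sum_truncate_weight_le hfin hR hv Λ Y x) A B ht
  rw [Metric.infDist_zero_of_mem (Finset.mem_coe.2 hy)]
  simp

end Interaction

/-! ### Comparison with the truncated dynamics -/

section Comparison

variable {Ω : Type*} [MetricSpace Ω] {H : Ω → Type*} [∀ x, NormedAddCommGroup (H x)]
  [∀ x, InnerProductSpace ℂ (H x)] [∀ x, CompleteSpace (H x)]

theorem setDist_nonneg (X Y : Finset Ω) : 0 ≤ setDist X Y :=
  Real.sInf_nonneg fun _ ⟨_, _, _, _, h⟩ => h ▸ dist_nonneg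

theorem setDist_le_infDist {X Y : Finset Ω} {x : Ω} (hx : x ∈ X) :
    setDist X Y ≤ Metric.infDist x (Y : Set Ω) := by
  -- For empty `Y` both distances take the default value 0.
  rcases Y.eq_empty_or_nonempty with rfl | hY
  · simp [setDist]
  · refine (Metric.le_infDist (Finset.coe_nonempty.2 hY)).2 fun y hy => ?_
    exact csInf_le ⟨0, fun _ ⟨_, _, _, _, h⟩ => h ▸ dist_nonneg⟩ ⟨x, hx, y, hy, rfl⟩

/-- Exchange the sums: for a fixed site `z`, the terms of diameter at least `R` through `z` have
total norm at most `f R`. -/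
theorem sum_norm_mul_sum_sum_le [DecidableEq Ω] {h : ∀ Z : Finset Ω, Observable H Z} {f : ℝ → ℝ}
    (hA : AssumptionA h f) {R : ℝ} (hR : 0 ≤ R) (Λ X : Finset Ω) {u : Ω → Ω → ℝ}
    (hu : ∀ x y, 0 ≤ u x y) :
    ∑ Z ∈ Λ.powerset with R ≤ Metric.diam ((Z : Finset Ω) : Set Ω),
        ‖h Z‖ * ∑ x ∈ X, ∑ z ∈ Z, u x z ≤
      ∑ x ∈ X, ∑ z ∈ Λ, u x z * f R := by
  set S := Λ.powerset.filter fun Z : Finset Ω => R ≤ Metric.diam (Z : Set Ω) with hS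
  have h1 : ∀ Z ∈ S, ‖h Z‖ * ∑ x ∈ X, ∑ z ∈ Z, u x z =
      ∑ x ∈ X, ∑ z ∈ Λ, u x z * (if z ∈ Z then ‖h Z‖ else 0) := by
    intro Z hZ
    have hZΛ : Z ⊆ Λ := Finset.mem_powerset.1 (Finset.mem_filter.1 hZ).1
    rw [Finset.mul_sum]
    refine Finset.sum_congr rfl fun x _ => ?_
    simp only [mul_ite, mul_zero]
    rw [← Finset.sum_filter, Finset.filter_mem_eq_inter, Finset.inter_eq_right.2 hZΛ,
      ← Finset.sum_mul, mul_comm]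
  rw [Finset.sum_congr rfl h1, Finset.sum_comm]
  refine Finset.sum_le_sum fun x _ => ?_
  rw [Finset.sum_comm]
  refine Finset.sum_le_sum fun z _ => ?_
  rw [← Finset.mul_sum]
  refine mul_le_mul_of_nonneg_left ?_ (hu x z)
  rw [← Finset.sum_filter, hS, Finset.filter_filter]
  refine le_of_eq_of_le ?_ (sum_norm_tail_le hA hR Λ.powerset z)
  exact Finset.sum_congr (Finset.filter_congr fun Z _ => and_comm) fun _ _ => rfl

/-- The commutator of the truncated dynamics with a local term: the trivial bound if `Z` is close
to `X`, the Lieb–Robinson bound otherwise. -/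
theorem norm_lie_localTerm_le {h : ∀ Z : Finset Ω, Observable H Z}
    (hs : ∀ Z, IsSelfAdjoint (h Z)) (hfin : couplingConst h < ∞) {v R r : ℝ} (hR : 0 < R)
    (hv : 2 * Real.exp 1 * (couplingConst h).toReal ≤ v) {Λ X Z : Finset Ω} (hX : X ⊆ Λ)
    (hZ : Z ⊆ Λ) (hne : Z.Nonempty) (A : Observable H X) {t : ℝ} (ht : 0 ≤ t) :
    ‖⁅heis (hamiltonian (truncate h R) Λ) t (embed H hX A), localTerm h Λ Z⁆‖ ≤
      2 * ‖A‖ * (‖h Z‖ * ∑ x ∈ X, ∑ z ∈ Z,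
        if dist x z ≤ r then 1 else Real.exp (v * t) * Real.exp (-dist x z / R)) := by
  have hself : IsSelfAdjoint (hamiltonian (truncate h R) Λ) := by
    rw [hamiltonian_eq_sum]
    exact isSelfAdjoint_sum_localTerm (isSelfAdjoint_truncate hs R) _ _
  rw [localTerm_of_subset h hZ]
  set u : Ω → Ω → ℝ := fun x z =>
    if dist x z ≤ r then 1 else Real.exp (v * t) * Real.exp (-dist x z / R) with hu
  have hu0 : ∀ x z, 0 ≤ u x z := fun x z => by
    simp only [hu]
    split_ifs <;> positivity
  have hle : ∀ x ∈ X, ∀ z ∈ Z, u x z ≤ ∑ x ∈ X, ∑ z ∈ Z, u x z := fun x hx z hz =>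
    (Finset.single_le_sum (fun z _ => hu0 x z) hz).trans
      (Finset.single_le_sum (f := fun x => ∑ z ∈ Z, u x z)
        (fun x _ => Finset.sum_nonneg fun z _ => hu0 x z) hx)
  by_cases hnear : ∃ x ∈ X, ∃ z ∈ Z, dist x z ≤ r
  · obtain ⟨x, hx, z, hz, hd⟩ := hnear
    have h1 : 1 ≤ ∑ x ∈ X, ∑ z ∈ Z, u x z := by
      simpa [hu, hd] using hle x hx z hz
    have hAn : ‖embed H hX A‖ ≤ ‖A‖ := norm_amp_le _ A
    have hZn : ‖embed H hZ (h Z)‖ ≤ ‖h Z‖ := norm_amp_le _ (h Z)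
    calc _ ≤ 2 * ‖heis (hamiltonian (truncate h R) Λ) t (embed H hX A)‖ *
            ‖embed H hZ (h Z)‖ := norm_lie_le _ _
      _ ≤ 2 * ‖A‖ * (‖h Z‖ * 1) := by
        rw [norm_heis hself, mul_one]
        gcongr
      _ ≤ _ := by gcongr
  · push Not at hnear
    refine (norm_lie_heis_truncate_le hs hfin hR hv hX hZ A (h Z) ht).trans ?_
    rw [mul_assoc (2 * ‖A‖), Finset.mul_sum]
    gcongr with x hx
    -- The distance to the finite set `Z` is attained, so a single summand already dominates the
    -- weight of `x`.
    obtain ⟨z, hz, hdist⟩ := (Z.finite_toSet.isCompact).exists_infDist_eq_dist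
      (Finset.coe_nonempty.2 hne) x
    rw [hdist]
    refine le_of_eq_of_le ?_ (Finset.single_le_sum (fun z _ => hu0 x z) (Finset.mem_coe.1 hz))
    simp [hu, not_le.2 (hnear x hx z hz)]

/-- The truncated dynamics approximates the full dynamics. -/
theorem norm_heis_truncate_sub_le {g : ℝ → ℝ} {C D : ℝ} (hC : 0 < C) (hD : 0 < D)
    (hg_count : ∀ (x : Ω) (r : ℝ), 0 ≤ r →
      {y : Ω | dist x y ≤ r}.Finite ∧ ({y : Ω | dist x y ≤ r}.ncard : ℝ) ≤ g r)
    (hg_le : ∀ r : ℝ, 0 ≤ r → g r ≤ C * (1 + r) ^ D)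
    {h : ∀ Z : Finset Ω, Observable H Z} (hs : ∀ Z, IsSelfAdjoint (h Z)) {f : ℝ → ℝ}
    (hA : AssumptionA h f) {v R r : ℝ} (hR : 1 ≤ R) (hr : 0 ≤ r) (hv0 : 0 < v)
    (hv : 2 * Real.exp 1 * (couplingConst h).toReal ≤ v) {Λ X : Finset Ω} (hX : X ⊆ Λ)
    (A : Observable H X) {t : ℝ} (ht : 0 ≤ t) :
    ‖heis (hamiltonian (truncate h R) Λ) t (embed H hX A) -
        heis (hamiltonian h Λ) t (embed H hX A)‖ ≤
      2 * ‖A‖ * (X.card * (g r + (C * ∑' k : ℕ, ((k : ℝ) + 3) ^ D * Real.exp (-k)) *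
        max r R ^ D * Real.exp (v * t - r / R)) * f R) * t := by
  classical
  have hR0 : 0 < R := by linarith
  have hself : IsSelfAdjoint (hamiltonian h Λ) := by
    rw [hamiltonian_eq_sum]
    exact isSelfAdjoint_sum_localTerm hs _ _
  set K := C * ∑' k : ℕ, ((k : ℝ) + 3) ^ D * Real.exp (-k) with hK
  -- The truncated Hamiltonian takes the first slot, so that the commutators to be estimated contain
  -- the truncated evolution, for which a Lieb–Robinson bound is available.
  refine norm_heis_sub_heis_le hself (embed H hX A) (φ := fun s => 2 * ‖A‖ * (X.card *
    (g r + K * max r R ^ D * Real.exp (v * t - r / R)) * f R) * s) ht (by simp)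
    (fun s => by simpa using (hasDerivAt_id s).const_mul (2 * ‖A‖ * (X.card *
      (g r + K * max r R ^ D * Real.exp (v * t - r / R)) * f R))) fun s hs0 hst => ?_
  have hneg : hamiltonian (truncate h R) Λ - hamiltonian h Λ =
      ∑ Z ∈ Λ.powerset with R ≤ Metric.diam ((Z : Finset Ω) : Set Ω), -localTerm h Λ Z := by
    rw [Finset.sum_neg_distrib, ← hamiltonian_sub_truncate, neg_sub]
  let u : Ω → Ω → ℝ := fun x z =>
    if dist x z ≤ r then 1 else Real.exp (v * s) * Real.exp (-dist x z / R)
  have hu0 : ∀ x z, 0 ≤ u x z := fun x z => by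
    simp only [u]
    split_ifs <;> positivity
  have hsum : ∀ x, ∑ z ∈ Λ, u x z ≤ g r + K * max r R ^ D * Real.exp (v * t - r / R) := by
    intro x
    obtain ⟨hfin, hcard⟩ := hg_count x r hr
    simp only [u]
    rw [Finset.sum_ite]
    refine add_le_add ?_ ?_
    · rw [Finset.sum_const, nsmul_eq_mul, mul_one]
      refine le_trans (Nat.cast_le.2 ?_) hcard
      rw [← Set.ncard_coe_finset]
      exact Set.ncard_le_ncard (fun y hy => (Finset.mem_filter.1 (Finset.mem_coe.1 hy)).2) hfin
    · rw [← Finset.mul_sum]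
      have h1 := sum_exp_neg_dist_le hC hD (x := x) (fun ρ hρ => ⟨(hg_count x ρ hρ).1,
        (hg_count x ρ hρ).2.trans (hg_le ρ hρ)⟩) Λ hr hR
      calc _ ≤ Real.exp (v * t) * (K * max r R ^ D * Real.exp (-r / R)) := by gcongr
        _ = K * max r R ^ D * Real.exp (v * t - r / R) := by
          rw [sub_eq_add_neg, Real.exp_add, neg_div]
          ring
  rw [hneg]
  calc _ ≤ ∑ Z ∈ Λ.powerset with R ≤ Metric.diam ((Z : Finset Ω) : Set Ω),
          ‖⁅-localTerm h Λ Z, heis (hamiltonian (truncate h R) Λ) s (embed H hX A)⁆‖ :=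
        norm_sum_lie_le _ _ _
    _ ≤ ∑ Z ∈ Λ.powerset with R ≤ Metric.diam ((Z : Finset Ω) : Set Ω),
          2 * ‖A‖ * (‖h Z‖ * ∑ x ∈ X, ∑ z ∈ Z, u x z) := by
        refine Finset.sum_le_sum fun Z hZ => ?_
        obtain ⟨hZ1, hZ2⟩ := Finset.mem_filter.1 hZ
        -- The empty set has diameter 0 and hence is absent from the tail, as `R > 0`.
        have hne : Z.Nonempty := by
          rw [Finset.nonempty_iff_ne_empty]
          rintro rfl
          simp only [Finset.coe_empty, Metric.diam_empty] at hZ2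
          linarith
        rw [norm_neg_lie, norm_lie_comm]
        exact norm_lie_localTerm_le hs hA.finite hR0 hv hX (Finset.mem_powerset.1 hZ1) hne A hs0
    _ ≤ 2 * ‖A‖ * ∑ x ∈ X, ∑ z ∈ Λ, u x z * f R := by
        rw [← Finset.mul_sum]
        gcongr
        exact sum_norm_mul_sum_sum_le hA hR0.le Λ X hu0
    _ ≤ 2 * ‖A‖ * ∑ x ∈ X, (g r + K * max r R ^ D * Real.exp (v * t - r / R)) * f R := by
        gcongr with x
        rw [← Finset.sum_mul]
        exact mul_le_mul_of_nonneg_right (hsum x) (hA.nonneg R hR0.le)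
    _ = _ := by
        rw [Finset.sum_const, nsmul_eq_mul]
        ring

end Comparison

end QSpin

theorem theorem2p1 {Ω : Type*} [Countable Ω] [MetricSpace Ω] [DiscreteTopology Ω]
    (g : ℝ → ℝ) (C D : ℝ) (hC : 0 < C) (hD : 0 < D)
    (hg_mono : MonotoneOn g (Set.Ici 0))
    (hg_count : ∀ (x : Ω) (r : ℝ), 0 ≤ r →
      {y : Ω | dist x y ≤ r}.Finite ∧ ({y : Ω | dist x y ≤ r}.ncard : ℝ) ≤ g r)
    (hg_le : ∀ r : ℝ, 0 ≤ r → g r ≤ C * (1 + r) ^ D)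
    (H : Ω → Type*) [∀ x, NormedAddCommGroup (H x)] [∀ x, InnerProductSpace ℂ (H x)]
    [∀ x, CompleteSpace (H x)]
    (h : ∀ Z : Finset Ω, QSpin.Observable H Z) (h_sa : ∀ Z, IsSelfAdjoint (h Z))
    (f : ℝ → ℝ) (hA : QSpin.AssumptionA h f) :
    ∃ v C₂ : ℝ, 0 < v ∧ 0 < C₂ ∧
      (QSpin.couplingConst h ≠ 0 → v = 2 * Real.exp 1 * (QSpin.couplingConst h).toReal) ∧
      ∀ (Λ X Y : Finset Ω) (hX : X ⊆ Λ) (hY : Y ⊆ Λ)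
        (A : QSpin.Observable H X) (B : QSpin.Observable H Y) (R t : ℝ), 1 ≤ R → 0 ≤ t →
        ‖⁅QSpin.evolve h Λ t (QSpin.embed H hX A), QSpin.embed H hY B⁆‖ ≤
          2 * ‖A‖ * ‖B‖ * (X.card : ℝ) * Real.exp (v * t - QSpin.setDist X Y / R)
          + 4 * ‖A‖ * ‖B‖ * (X.card : ℝ) * t * g (QSpin.setDist X Y) * f R
          + 2 * C₂ * ‖A‖ * ‖B‖ * (X.card : ℝ) ^ 2 * t * R
            * (max (QSpin.setDist X Y) R) ^ D * f R
            * Real.exp (v * t - QSpin.setDist X Y / R) := by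
  obtain ⟨v, hv0, hv, hveq⟩ : ∃ v : ℝ, 0 < v ∧
      2 * Real.exp 1 * (QSpin.couplingConst h).toReal ≤ v ∧
      (QSpin.couplingConst h ≠ 0 → v = 2 * Real.exp 1 * (QSpin.couplingConst h).toReal) := by
    -- Without coupling any positive velocity works; 1 is chosen.
    by_cases h0 : QSpin.couplingConst h = 0
    · exact ⟨1, one_pos, by simp [h0], fun hne => absurd h0 hne⟩
    · have := ENNReal.toReal_pos h0 hA.finite.ne
      exact ⟨_, by positivity, le_rfl, fun _ => rfl⟩
  set K := C * ∑' k : ℕ, ((k : ℝ) + 3) ^ D * Real.exp (-k) with hK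
  have hK0 : 0 < K := by
    refine mul_pos hC ((QSpin.summable_rpow_mul_exp_neg D).tsum_pos (fun k => by positivity) 0 ?_)
    positivity
  refine ⟨v, 2 * K, hv0, by positivity, hveq, fun Λ X Y hX hY A B R t hR ht => ?_⟩
  have hR0 : 0 < R := by linarith
  set r := QSpin.setDist X Y with hr
  have hr0 : 0 ≤ r := QSpin.setDist_nonneg X Y
  set E := Real.exp (v * t - r / R) with hE
  have hB : ‖QSpin.embed H hY B‖ ≤ ‖B‖ := QSpin.norm_amp_le _ B
  have hfR := hA.nonneg R hR0.le
  have hLR : ‖⁅QSpin.heis (QSpin.hamiltonian (QSpin.truncate h R) Λ) t (QSpin.embed H hX A),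
      QSpin.embed H hY B⁆‖ ≤ 2 * ‖A‖ * ‖B‖ * (X.card * E) := by
    refine (QSpin.norm_lie_heis_truncate_le h_sa hA.finite hR0 hv hX hY A B ht).trans ?_
    refine mul_le_mul_of_nonneg_left ?_ (by positivity)
    rw [Finset.mul_sum, ← nsmul_eq_mul]
    refine Finset.sum_le_card_nsmul _ _ _ fun x hx => ?_
    rw [← Real.exp_add, hE, Real.exp_le_exp, sub_eq_add_neg, ← neg_div]
    gcongr
    exact QSpin.setDist_le_infDist hx
  have hcomp := QSpin.norm_heis_truncate_sub_le hC hD hg_count hg_le h_sa hA hR hr0 hv0 hv hX A ht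
  rw [← hK, ← hE] at hcomp
  -- The argument yields the last term with `|X|` alone; the factor `|X|² R` of the claim is a
  -- weakening.
  have hcard : (X.card : ℝ) ≤ (X.card : ℝ) ^ 2 * R := by
    have h1 : (X.card : ℝ) ≤ (X.card : ℝ) ^ 2 := by
      exact_mod_cast Nat.le_self_pow two_ne_zero X.card
    exact h1.trans (le_mul_of_one_le_right (by positivity) hR)
  rw [QSpin.evolve_eq_heis, QSpin.norm_lie_comm]
  calc _ ≤ 2 * ‖A‖ * ‖B‖ * (X.card * E) +
        2 * ‖B‖ * (2 * ‖A‖ * (X.card * (g r + K * max r R ^ D * E) * f R) * t) := by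
        refine (QSpin.norm_lie_le_add_right _ _
          (QSpin.heis (QSpin.hamiltonian (QSpin.truncate h R) Λ) t (QSpin.embed H hX A))).trans ?_
        rw [QSpin.norm_lie_comm, norm_sub_rev]
        gcongr
    _ = 2 * ‖A‖ * ‖B‖ * X.card * E + 4 * ‖A‖ * ‖B‖ * X.card * t * g r * f R +
        4 * K * ‖A‖ * ‖B‖ * X.card * t * max r R ^ D * f R * E := by ring
    _ ≤ 2 * ‖A‖ * ‖B‖ * X.card * E + 4 * ‖A‖ * ‖B‖ * X.card * t * g r * f R +
        4 * K * ‖A‖ * ‖B‖ * ((X.card : ℝ) ^ 2 * R) * t * max r R ^ D * f R * E := by gcongr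
    _ = _ := by ring
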